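/- Let $\Delta$ be the simplex category, let $\mathrm{op}:\Delta\to\Delta$ be the endofunctor that reverses the ordering of the objects, and let $\star:\Delta\times\Delta\to\Delta$ be the join (concatenation) $[m]\star[n]=[m+n+1]$. Put $\varepsilon:=\mathrm{op}\star\mathrm{id}:\Delta\to\Delta$, so that $\varepsilon([n])=[n]^{\mathrm{op}}\star[n]=[2n+1]$, and let $\tilde{\mathcal O}:=\varepsilon^*:\mathbf{sSet}\to\mathbf{sSet}$ be precomposition with $\varepsilon$, so that $\tilde{\mathcal O}(X)_n=X([n]^{\mathrm{op}}\star[n])=X_{2n+1}$. For a simplicial set $X$, write $X^{\mathrm{op}}$ for its opposite, that is, for $X$ precomposed with $\mathrm{op}$. **Proposition.** For any $\infty$-category (quasicategory) $C$, the map of simplicial sets $$\tilde{\mathcal O}(C)\to C^{\mathrm{op}}\times C$$ induced by the inclusions $\mathrm{op}\hookrightarrow\mathrm{op}\star\mathrm{id}$ and $\mathrm{id}\hookrightarrow\mathrm{op}\star\mathrm{id}$ is a left fibration; that is, it has the right lifting property with respect to the horn inclusions $\Lambda^n_i\hookrightarrow\Delta^n$ for all $n\ge 1$ and $0\le i<n$.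 In particular, $\tilde{\mathcal O}(C)$ is an $\infty$-category. -/

import Mathlib

open CategoryTheory MonoidalCategory Simplicial

universe u

namespace TwistedArrow

/-- The join (concatenation) `⋆ : Δ × Δ ⥤ Δ`, `([m], [n]) ↦ [m] ⋆ [n] = [m + n + 1]`. It is the
restriction to nonempty ordinals of Mathlib's ordinal sum on the augmented simplex category. -/
def join : SimplexCategory × SimplexCategory ⥤ SimplexCategory where
  obj x := AugmentedSimplexCategory.tensorObjOf x.1 x.2
  map f := AugmentedSimplexCategory.tensorHomOf f.1 f.2
  map_id x := MonoidalCategory.id_tensorHom_id (C := AugmentedSimplexCategory)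
    (.of x.1) (.of x.2)
  map_comp {x y z} f g := (MonoidalCategory.tensorHom_comp_tensorHom
    (C := AugmentedSimplexCategory) (X₁ := .of x.1) (Y₁ := .of y.1) (Z₁ := .of z.1)
    (X₂ := .of x.2) (Y₂ := .of y.2) (Z₂ := .of z.2) f.1 f.2 g.1 g.2).symm

/-- The join of two endofunctors of `Δ`: `(F ⋆ G)[m] = F[m] ⋆ G[m]`. -/
def endJoin (F G : SimplexCategory ⥤ SimplexCategory) : SimplexCategory ⥤ SimplexCategory :=
  F.prod' G ⋙ join

/-- The inclusion `F ↪ F ⋆ G` as the initial segment. -/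
def endJoinInl (F G : SimplexCategory ⥤ SimplexCategory) : F ⟶ endJoin F G where
  app n := AugmentedSimplexCategory.inl' (F.obj n) (G.obj n)
  naturality {m n} f := (AugmentedSimplexCategory.inl_comp_tensorHom
    (x₁ := .of (F.obj m)) (y₁ := .of (F.obj n)) (x₂ := .of (G.obj m)) (y₂ := .of (G.obj n))
    (F.map f) (G.map f)).symm

/-- The inclusion `G ↪ F ⋆ G` as the final segment. -/
def endJoinInr (F G : SimplexCategory ⥤ SimplexCategory) : G ⟶ endJoin F G where
  app n := AugmentedSimplexCategory.inr' (F.obj n) (G.obj n)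
  naturality {m n} f := (AugmentedSimplexCategory.inr_comp_tensorHom
    (x₁ := .of (F.obj m)) (y₁ := .of (F.obj n)) (x₂ := .of (G.obj m)) (y₂ := .of (G.obj n))
    (F.map f) (G.map f)).symm

/-- The endofunctor `ε = op ⋆ id` of `Δ`, `[n] ↦ [n]ᵒᵖ ⋆ [n] = [2n + 1]`. Here the endofunctor
`op`, which reverses the orders, is `SimplexCategory.rev`. -/
def epsilon : SimplexCategory ⥤ SimplexCategory :=
  endJoin SimplexCategory.rev (𝟭 SimplexCategory)

/-- The functor `Õ = ε^* : sSet ⥤ sSet`, given by precomposition with `ε`. -/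
def twistedArrow : SSet.{u} ⥤ SSet.{u} :=
  (Functor.whiskeringLeft _ _ (Type u)).obj epsilon.op

/-- The map `Õ(C) ⟶ Cᵒᵖ` induced by the inclusion `op ↪ op ⋆ id`. By definition `C.op` is `C`
precomposed with `SimplexCategory.rev`. -/
def toOp (C : SSet.{u}) : twistedArrow.obj C ⟶ C.op :=
  Functor.whiskerRight (NatTrans.op (endJoinInl SimplexCategory.rev (𝟭 SimplexCategory))) C

/-- The map `Õ(C) ⟶ C` induced by the inclusion `id ↪ op ⋆ id`. -/
def toSelf (C : SSet.{u}) : twistedArrow.obj C ⟶ C :=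
  Functor.whiskerRight (NatTrans.op (endJoinInr SimplexCategory.rev (𝟭 SimplexCategory))) C

/-- The map `Õ(C) ⟶ Cᵒᵖ × C` (`⊗` is the cartesian product of simplicial sets). -/
def projection (C : SSet.{u}) : twistedArrow.obj C ⟶ C.op ⊗ C :=
  CartesianMonoidalCategory.lift (toOp C) (toSelf C)

/-- The left horn inclusions `Λ[n, i] ⟶ Δ[n]`, for `n ≥ 1` and `0 ≤ i < n`. -/
inductive leftHornInclusions : MorphismProperty SSet.{u} where
  | intro {n : ℕ} (i : Fin (n + 2)) (hn : i < Fin.last (n + 1)) :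
    leftHornInclusions Λ[n + 1, i].ι

/-- The left fibrations: the maps with the right lifting property with respect to all
left horn inclusions. -/
def leftFibrations : MorphismProperty SSet.{u} := leftHornInclusions.rlp

end TwistedArrow

/-! Put `m = n + 1`. By Yoneda, an `m`-simplex of `Õ(C)` is a map `Δ[2m+1] ⟶ C`, so a lifting
problem against `Λ[m, i]` is an extension problem along `twistedHorn m i ⊆ Δ[2m+1]`: the data on
`Δ[m]ᵒᵖ` and `Δ[m]` come from the base, those on the joins `σᵒᵖ ⋆ σ` from the horn. They agree on
overlaps, hence glue (`IsValue.unique`, `desc`).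

It remains to see that this inclusion is inner anodyne when `i < m`
(`innerAnodyneExtensions_twistedHorn_ι`). A missing simplex is a set of vertices that meets both
halves and contains a copy of every `j ≠ i`. Such sets are paired by adding or removing one copy of
`i`: the second copy if some vertex lies above it, the first copy otherwise. That vertex is never
extreme, and the pairing is regular, so the missing simplices can be attached along inner horns.

Finally, left fibrations are inner fibrations and `Cᵒᵖ × C` is a quasicategory, so `Õ(C)` is one. -/

namespace SSet

open Opposite

/-! ### Nondegenerate simplices of `Δ[n]` as sets of vertices. -/

namespace stdSimplex

/-- The set of vertices of a simplex of a standard simplex. -/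
def vertices {n d : ℕ} (x : (Δ[n] : SSet.{u}) _⦋d⦌) : Finset (Fin (n + 1)) :=
  Finset.univ.image x

lemma mem_vertices {n d : ℕ} (x : (Δ[n] : SSet.{u}) _⦋d⦌) (j : Fin (n + 1)) :
    j ∈ vertices x ↔ ∃ i, x i = j := by
  simp [vertices]

lemma vertices_eq_nonDegenerateEquiv' {n d : ℕ} (x : (Δ[n] : SSet.{u}).nonDegenerate d) :
    vertices x.val = (nonDegenerateEquiv' x).val := by
  ext j
  rw [nonDegenerateEquiv'_iff, mem_vertices]

lemma face_vertices {n : ℕ} (x : (Δ[n] : SSet.{u}).N) :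
    face (vertices x.simplex) = x.subcomplex := by
  rw [vertices_eq_nonDegenerateEquiv' ⟨_, x.nonDegenerate⟩]
  exact face_nonDegenerateEquiv' ⟨_, x.nonDegenerate⟩

lemma card_vertices {n : ℕ} (x : (Δ[n] : SSet.{u}).N) :
    (vertices x.simplex).card = x.dim + 1 := by
  rw [vertices_eq_nonDegenerateEquiv' ⟨_, x.nonDegenerate⟩]
  exact (nonDegenerateEquiv' ⟨_, x.nonDegenerate⟩).2

lemma le_iff_vertices_subset {n : ℕ} (x y : (Δ[n] : SSet.{u}).N) :
    x ≤ y ↔ vertices x.simplex ⊆ vertices y.simplex := by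
  rw [N.le_iff, ← face_vertices, ← face_vertices, face_le_face_iff]

lemma eq_of_vertices_eq {n : ℕ} {x y : (Δ[n] : SSet.{u}).N}
    (h : vertices x.simplex = vertices y.simplex) : x = y :=
  N.subcomplex_injective (by rw [← face_vertices, ← face_vertices, h])

lemma exists_vertices_eq {n : ℕ} (S : Finset (Fin (n + 1))) (hS : S.Nonempty) :
    ∃ x : (Δ[n] : SSet.{u}).N, vertices x.simplex = S := by
  obtain ⟨d, hd⟩ : ∃ d, S.card = d + 1 := Nat.exists_eq_add_one.2 hS.card_pos
  refine ⟨N.mk _ (nonDegenerateEquiv'.{u}.symm ⟨S, hd⟩).2, ?_⟩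
  exact (vertices_eq_nonDegenerateEquiv' _).trans
    (congr_arg Subtype.val (Equiv.apply_symm_apply _ _))

end stdSimplex

/-! ### Inner anodyne subcomplexes of `Δ[n]` from toggling a vertex. -/

namespace Subcomplex

open SSet.stdSimplex

variable {n : ℕ} {A : (Δ[n] : SSet.{u}).Subcomplex}

lemma N.not_face_vertices_le (x : A.N) : ¬ face (vertices x.simplex) ≤ A := by
  rw [show face (vertices x.simplex) = x.subcomplex from face_vertices x.toN]
  simpa using x.notMem

lemma N.eq_of_vertices_eq {x y : A.N} (h : vertices x.simplex = vertices y.simplex) : x = y :=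
  (N.ext_iff x y).2 (stdSimplex.eq_of_vertices_eq h)

variable (A) in
lemma exists_N_vertices_eq (S : Finset (Fin (n + 1))) (hS : ¬ face S ≤ A) :
    ∃ x : A.N, vertices x.simplex = S := by
  obtain ⟨x, rfl⟩ := exists_vertices_eq.{u} S (by
    rw [Finset.nonempty_iff_ne_empty]
    rintro rfl
    simp at hS)
  exact ⟨N.mk' x (by rw [face_vertices] at hS; simpa using hS), rfl⟩

/-- The nondegenerate simplex of `Δ[n]`, not in `A`, with a given set of vertices. -/
noncomputable def N.ofVertices (S : Finset (Fin (n + 1))) (hS : ¬ face S ≤ A) : A.N :=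
  (exists_N_vertices_eq A S hS).choose

@[simp]
lemma N.vertices_ofVertices (S : Finset (Fin (n + 1))) (hS : ¬ face S ≤ A) :
    vertices (N.ofVertices S hS).simplex = S :=
  (exists_N_vertices_eq A S hS).choose_spec

variable (A) in
/-- A way of adding or removing one vertex of each simplex of `Δ[n]` which is not in `A`,
so that all the horns involved are inner. -/
structure InnerToggle where
  /-- the vertex that is added to or removed from a set of vertices -/
  vertex (S : Finset (Fin (n + 1))) : Fin (n + 1)
  not_face_erase_le (S : Finset (Fin (n + 1))) (hS : ¬ face.{u} S ≤ A) :
    ¬ face.{u} (S.erase (vertex S)) ≤ A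
  vertex_insert (S : Finset (Fin (n + 1))) (hS : ¬ face.{u} S ≤ A) :
    vertex (insert (vertex S) S) = vertex S
  vertex_erase (S : Finset (Fin (n + 1))) (hS : ¬ face.{u} S ≤ A) :
    vertex (S.erase (vertex S)) = vertex S
  exists_lt (S : Finset (Fin (n + 1))) (hS : ¬ face.{u} S ≤ A) : ∃ a ∈ S, a < vertex S
  exists_gt (S : Finset (Fin (n + 1))) (hS : ¬ face.{u} S ≤ A) : ∃ a ∈ S, vertex S < a
  /-- a rank which decreases along ancestrality relations in a given dimension -/
  rank (S : Finset (Fin (n + 1))) : ℕ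
  -- The last two hypotheses describe a face `S` of the larger simplex paired with `T`; `vertex T ∈
  -- S` rules out `S = T`.
  rank_lt (S T : Finset (Fin (n + 1))) (hS : ¬ face.{u} S ≤ A) (hT : ¬ face.{u} T ≤ A)
    (hvS : vertex S ∉ S) (hvT : vertex T ∉ T) (h : vertex T ∈ S)
    (hST : S ⊆ insert (vertex T) T) : rank S < rank T

namespace InnerToggle

variable (t : A.InnerToggle)

lemma not_face_insert_le (S : Finset (Fin (n + 1))) (hS : ¬ face.{u} S ≤ A) :
    ¬ face.{u} (insert (t.vertex S) S) ≤ A :=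
  fun h ↦ hS (((face_le_face_iff _ _).2 (Finset.subset_insert _ _)).trans h)

/-- The pairing which adds or removes a vertex. -/
noncomputable def pairing : A.Pairing where
  I := {x | t.vertex (vertices x.simplex) ∈ vertices x.simplex}
  II := {x | t.vertex (vertices x.simplex) ∉ vertices x.simplex}
  inter := by
    ext x
    simp
  union := by
    ext x
    simpa using em _
  p :=
    { toFun x := ⟨N.ofVertices _ (t.not_face_insert_le _ x.1.not_face_vertices_le), by
        simp [t.vertex_insert _ x.1.not_face_vertices_le]⟩
      invFun x := ⟨N.ofVertices _ (t.not_face_erase_le _ x.1.not_face_vertices_le), by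
        simp [t.vertex_erase _ x.1.not_face_vertices_le]⟩
      left_inv x := by
        ext1
        apply N.eq_of_vertices_eq
        simp only [N.vertices_ofVertices, t.vertex_insert _ x.1.not_face_vertices_le]
        exact Finset.erase_insert x.2
      right_inv x := by
        ext1
        apply N.eq_of_vertices_eq
        simp only [N.vertices_ofVertices, t.vertex_erase _ x.1.not_face_vertices_le]
        exact Finset.insert_erase x.2 }

lemma vertices_pairing_p (x : t.pairing.II) :
    vertices (t.pairing.p x).1.simplex =
      insert (t.vertex (vertices x.1.simplex)) (vertices x.1.simplex) :=
  N.vertices_ofVertices _ (t.not_face_insert_le _ x.1.not_face_vertices_le)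

lemma vertex_notMem (x : t.pairing.II) :
    t.vertex (vertices x.1.simplex) ∉ vertices x.1.simplex := x.2

instance : t.pairing.IsProper where
  isUniquelyCodimOneFace x := by
    refine ⟨?_, SSet.N.existsUnique_of_le ?_⟩
    · have h := card_vertices (t.pairing.p x).1.toN
      rw [vertices_pairing_p, Finset.card_insert_of_notMem (t.vertex_notMem x),
        card_vertices x.1.toN] at h
      exact (Nat.succ_injective h).symm
    · rw [le_iff_vertices_subset, vertices_pairing_p]
      exact Finset.subset_insert _ _

lemma apply_notMem_vertices_of_δ_eq {d : ℕ} {y : (Δ[n] : SSet.{u}) _⦋d + 1⦌} {x : (Δ[n] : SSet.{u}) _⦋d⦌}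
    (hy : y ∈ (Δ[n] : SSet.{u}).nonDegenerate _) {i : Fin (d + 2)}
    (h : (Δ[n] : SSet.{u}).δ i y = x) : y i ∉ vertices x := by
  rw [mem_vertices]
  rintro ⟨j, hj⟩
  rw [← h, δ_apply] at hj
  exact Fin.succAbove_ne _ _ (((mem_nonDegenerate_iff_strictMono y).1 hy).injective hj)

/-- The larger simplex of a pair, with a prescribed dimension. -/
noncomputable abbrev cell (x : t.pairing.II) {d : ℕ} (hd : x.1.dim = d) :
    (Δ[n] : SSet.{u}).N :=
  (t.pairing.p x).1.toN.cast ((t.pairing.dim_p x).trans (congr_arg (· + 1) hd))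

lemma vertices_cell (x : t.pairing.II) {d : ℕ} (hd : x.1.dim = d) :
    vertices (t.cell x hd).simplex =
      insert (t.vertex (vertices x.1.simplex)) (vertices x.1.simplex) :=
  (congr_arg (fun z : (Δ[n] : SSet.{u}).N ↦ vertices z.simplex)
    (SSet.N.cast_eq_self _ _)).trans (t.vertices_pairing_p x)

lemma exists_apply_eq (x : t.pairing.II) {d : ℕ} (hd : x.1.dim = d) {a : Fin (n + 1)}
    (ha : a ∈ vertices x.1.simplex) : ∃ j : Fin (d + 2), (t.cell x hd).simplex j = a := by
  have := Finset.mem_insert_of_mem (b := t.vertex (vertices x.1.simplex)) ha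
  rwa [← t.vertices_cell x hd, mem_vertices] at this

/-- The face omits the vertex at its index, and the only vertex of the cell that it lacks is the
toggled one. Innerness thus becomes a condition on vertices. -/
lemma apply_index_eq_vertex (x : t.pairing.II) {d : ℕ} (hd : x.1.dim = d) :
    (t.cell x hd).simplex ((t.pairing.isUniquelyCodimOneFace x).index hd) =
      t.vertex (vertices x.1.simplex) := by
  subst hd
  have h := apply_notMem_vertices_of_δ_eq (t.cell x rfl).nonDegenerate
    ((t.pairing.isUniquelyCodimOneFace x).δ_index rfl)
  have := (mem_vertices (t.cell x rfl).simplex _).2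
    ⟨(t.pairing.isUniquelyCodimOneFace x).index rfl, rfl⟩
  rw [vertices_cell, Finset.mem_insert] at this
  exact this.resolve_right h

/-- An extreme index would make the toggled vertex the least or greatest one of the cell, against
`exists_lt` or `exists_gt`. -/
instance : t.pairing.IsInner where
  ne_zero x d hd h := by
    obtain ⟨a, ha, ha'⟩ := t.exists_lt _ x.1.not_face_vertices_le
    obtain ⟨j, hj⟩ := t.exists_apply_eq x hd ha
    rw [← t.apply_index_eq_vertex x hd, h, ← hj] at ha'
    exact (monotone_apply _ (Fin.zero_le j)).not_gt ha'
  ne_last x d hd h := by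
    obtain ⟨a, ha, ha'⟩ := t.exists_gt _ x.1.not_face_vertices_le
    obtain ⟨j, hj⟩ := t.exists_apply_eq x hd ha
    rw [← t.apply_index_eq_vertex x hd, h, ← hj] at ha'
    exact (monotone_apply _ (Fin.le_last j)).not_gt ha'

instance : t.pairing.IsRegular :=
  Pairing.WeakRankFunction.isRegular (α := ℕ)
    { rank x := t.rank (vertices x.1.simplex)
      lt {x y} h hd := by
        have hxy : vertices x.1.simplex ⊆
            insert (t.vertex (vertices y.1.simplex)) (vertices y.1.simplex) := by
          rw [← vertices_pairing_p]
          exact (le_iff_vertices_subset _ _).1 h.2.le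
        refine t.rank_lt _ _ x.1.not_face_vertices_le y.1.not_face_vertices_le
          (t.vertex_notMem x) (t.vertex_notMem y) ?_ hxy
        -- Otherwise `x` is contained in `y`; having the same dimension, the two would coincide.
        by_contra hv
        refine h.1 (Subtype.ext (N.eq_of_vertices_eq (Finset.eq_of_subset_of_card_le
          ((Finset.subset_insert_iff_of_notMem hv).1 hxy) ?_)))
        have h₁ := card_vertices x.1.toN
        have h₂ := card_vertices y.1.toN
        rw [h₁, h₂, hd] }

/-- If there is an inner toggle for `A`, then `A` is an inner anodyne subcomplex. -/
theorem innerAnodyneExtensions (t : A.InnerToggle) : innerAnodyneExtensions A.ι :=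
  t.pairing.innerAnodyneExtensions

end InnerToggle
end Subcomplex
end SSet

/-! ### The twisted horn inclusion is inner anodyne. -/

namespace TwistedArrow

open SSet SSet.stdSimplex

/-- The vertices of `[m]ᵒᵖ ⋆ [m]`. -/
abbrev Vertex (m : ℕ) : Type := Fin (m + m + 1 + 1)

/-- The map `[m]ᵒᵖ ⋆ [m] → [m]` which is the identity on both copies of `[m]`. -/
def fold {m : ℕ} (x : Vertex m) : Fin (m + 1) :=
  if x.val ≤ m then ⟨m - x, by omega⟩ else ⟨x - (m + 1), by omega⟩

lemma val_fold {m : ℕ} (x : Vertex m) :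
    (fold x).val = if x.val ≤ m then m - x.val else x.val - (m + 1) := by
  rw [fold]
  split_ifs <;> rfl

lemma eq_of_fold_eq {m : ℕ} {x y : Vertex m} (h : fold x = fold y)
    (h' : x.val ≤ m ↔ y.val ≤ m) : x = y := by
  rw [Fin.ext_iff, val_fold, val_fold] at h
  grind

/-- Those sets of vertices of `[m]ᵒᵖ ⋆ [m]` which lie in `[m]ᵒᵖ`, or in `[m]`, or which
avoid both copies of some element different from `i`. -/
def IsSmall {m : ℕ} (i : Fin (m + 1)) (S : Set (Vertex m)) : Prop :=
  (∀ x ∈ S, x.val ≤ m) ∨ (∀ x ∈ S, m < x.val) ∨ ∃ j ≠ i, ∀ x ∈ S, fold x ≠ j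

lemma IsSmall.subset {m : ℕ} {i : Fin (m + 1)} {S T : Set (Vertex m)}
    (hT : IsSmall i T) (h : S ⊆ T) : IsSmall i S :=
  hT.imp (fun hT x hx ↦ hT x (h hx)) (Or.imp (fun hT x hx ↦ hT x (h hx))
    (fun ⟨j, hj, hT⟩ ↦ ⟨j, hj, fun x hx ↦ hT x (h hx)⟩))

/-- The union in `Δ[m]ᵒᵖ ⋆ Δ[m]` of `Δ[m]ᵒᵖ`, `Δ[m]` and of the joins of the opposite of a face of
the horn `Λ[m, i]` with this face. -/
def twistedHorn (m : ℕ) (i : Fin (m + 1)) : (Δ[m + m + 1] : SSet.{u}).Subcomplex where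
  obj _ := {s | IsSmall i (Set.range (asOrderHom s))}
  map f _ hs := IsSmall.subset hs (by
    rintro _ ⟨k, rfl⟩
    exact ⟨f.unop.toOrderHom k, rfl⟩)

lemma mem_twistedHorn_iff {m : ℕ} (i : Fin (m + 1)) {d : SimplexCategoryᵒᵖ}
    (s : (Δ[m + m + 1] : SSet.{u}).obj d) :
    s ∈ (twistedHorn m i).obj d ↔ IsSmall i (Set.range (asOrderHom s)) := Iff.rfl

lemma face_le_twistedHorn_iff {m : ℕ} (i : Fin (m + 1)) (S : Finset (Vertex m)) :
    face.{u} S ≤ twistedHorn m i ↔ IsSmall i (S : Set (Vertex m)) := by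
  obtain rfl | hS := S.eq_empty_or_nonempty
  · simp [IsSmall]
  · obtain ⟨x, rfl⟩ := exists_vertices_eq.{u} S hS
    rw [face_vertices, Subcomplex.ofSimplex_le_iff, mem_twistedHorn_iff]
    have : (vertices x.simplex : Set (Vertex m)) =
        Set.range (asOrderHom x.simplex) := by
      ext
      simp only [Finset.mem_coe, mem_vertices]
      rfl
    rw [this]

section

variable {m : ℕ} (i : Fin (m + 1))

/-- The set contains an element which is greater than the second copy of `i`. -/
def HasLarge (S : Finset (Vertex m)) : Prop := ∃ x ∈ S, m + 1 + i.val < x.val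

open scoped Classical in
/-- The vertex used to pair the simplices which do not belong to `twistedHorn m i`. -/
noncomputable def pivot (S : Finset (Vertex m)) : Vertex m :=
  if HasLarge i S then ⟨m + 1 + i.val, by omega⟩ else ⟨m - i.val, by omega⟩

variable {i}

lemma val_pivot_of_hasLarge {S : Finset (Vertex m)} (hS : HasLarge i S) :
    (pivot i S).val = m + 1 + i.val := by
  simp [pivot, hS]

lemma val_pivot_of_not_hasLarge {S : Finset (Vertex m)} (hS : ¬ HasLarge i S) :
    (pivot i S).val = m - i.val := by
  simp [pivot, hS]

lemma val_pivot_le (S : Finset (Vertex m)) : (pivot i S).val ≤ m + 1 + i.val := by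
  by_cases hS : HasLarge i S
  · rw [val_pivot_of_hasLarge hS]
  · rw [val_pivot_of_not_hasLarge hS]
    omega

lemma fold_pivot (S : Finset (Vertex m)) : fold (pivot i S) = i := by
  ext
  rw [val_fold]
  by_cases hS : HasLarge i S
  · rw [val_pivot_of_hasLarge hS]
    grind
  · rw [val_pivot_of_not_hasLarge hS]
    grind

lemma pivot_eq_of_iff {S T : Finset (Vertex m)} (h : HasLarge i S ↔ HasLarge i T) :
    pivot i S = pivot i T := by
  by_cases hS : HasLarge i S
  · simp [pivot, hS, h.1 hS]
  · simp [pivot, hS, mt h.2 hS]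

/-- A pivot is at most the second copy of `i`, so it is never a large element. Toggling therefore
leaves the choice of pivot unchanged, and is an involution. -/
lemma hasLarge_insert_pivot (S T : Finset (Vertex m)) :
    HasLarge i (insert (pivot i T) S) ↔ HasLarge i S := by
  have := val_pivot_le (i := i) T
  simp only [HasLarge, Finset.mem_insert]
  grind

lemma hasLarge_erase_pivot (S T : Finset (Vertex m)) :
    HasLarge i (S.erase (pivot i T)) ↔ HasLarge i S := by
  have := val_pivot_le (i := i) T
  simp only [HasLarge, Finset.mem_erase]
  grind

lemma not_isSmall_iff (S : Finset (Vertex m)) :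
    ¬ IsSmall i (S : Set (Vertex m)) ↔
      (∃ x ∈ S, m < x.val) ∧ (∃ x ∈ S, x.val ≤ m) ∧ ∀ j ≠ i, ∃ x ∈ S, fold x = j := by
  simp [IsSmall]

/-- Here `i < m` matters: a copy of `m` must occur, its second copy would be large, and its first
copy is the vertex `0`. -/
lemma zero_mem_of_not_hasLarge (hi : i < Fin.last m) {S : Finset (Vertex m)}
    (hS : ¬ IsSmall i (S : Set (Vertex m))) (hS' : ¬ HasLarge i S) : 0 ∈ S := by
  rw [not_isSmall_iff] at hS
  obtain ⟨x, hx, hx'⟩ := hS.2.2 (Fin.last m) hi.ne'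
  have hx'' : ¬ m + 1 + i.val < x.val := fun h ↦ hS' ⟨x, hx, h⟩
  have hi' : i.val < m := hi
  rw [Fin.ext_iff, val_fold, Fin.val_last] at hx'
  obtain rfl : x = 0 := by
    ext
    rw [Fin.val_zero]
    grind
  exact hx

/-- The bound `x.val ≤ m` ensures that the first half is still met once the pivot is erased. -/
lemma exists_lt_pivot (hi : i < Fin.last m) {S : Finset (Vertex m)}
    (hS : ¬ IsSmall i (S : Set (Vertex m))) :
    ∃ x ∈ S, x.val ≤ m ∧ x < pivot i S := by
  have hi' : i.val < m := hi
  by_cases hS' : HasLarge i S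
  · obtain ⟨x, hx, hx'⟩ := ((not_isSmall_iff S).1 hS).2.1
    refine ⟨x, hx, hx', ?_⟩
    rw [Fin.lt_def, val_pivot_of_hasLarge hS']
    omega
  · refine ⟨0, zero_mem_of_not_hasLarge hi hS hS', by simp, ?_⟩
    rw [Fin.lt_def, val_pivot_of_not_hasLarge hS', Fin.val_zero]
    omega

lemma exists_pivot_lt {S : Finset (Vertex m)}
    (hS : ¬ IsSmall i (S : Set (Vertex m))) :
    ∃ x ∈ S, m < x.val ∧ pivot i S < x := by
  by_cases hS' : HasLarge i S
  · obtain ⟨x, hx, hx'⟩ := id hS'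
    refine ⟨x, hx, by omega, ?_⟩
    rwa [Fin.lt_def, val_pivot_of_hasLarge hS']
  · obtain ⟨x, hx, hx'⟩ := ((not_isSmall_iff S).1 hS).1
    refine ⟨x, hx, hx', ?_⟩
    rw [Fin.lt_def, val_pivot_of_not_hasLarge hS']
    omega

/-- Only a copy of `i` is lost, so each `j ≠ i` keeps its copy; the neighbours of the pivot found
above keep both halves inhabited. -/
lemma not_isSmall_erase_pivot (hi : i < Fin.last m) {S : Finset (Vertex m)}
    (hS : ¬ IsSmall i (S : Set (Vertex m))) :
    ¬ IsSmall i (S.erase (pivot i S) : Set (Vertex m)) := by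
  obtain ⟨x, hx, hx', hx''⟩ := exists_pivot_lt hS
  obtain ⟨y, hy, hy', hy''⟩ := exists_lt_pivot hi hS
  rw [not_isSmall_iff]
  refine ⟨⟨x, Finset.mem_erase.2 ⟨hx''.ne', hx⟩, hx'⟩,
    ⟨y, Finset.mem_erase.2 ⟨hy''.ne, hy⟩, hy'⟩, fun j hj ↦ ?_⟩
  obtain ⟨z, hz, hz'⟩ := ((not_isSmall_iff S).1 hS).2.2 j hj
  refine ⟨z, Finset.mem_erase.2 ⟨?_, hz⟩, hz'⟩
  rintro rfl
  exact hj (hz'.symm.trans (fold_pivot S))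

open scoped Classical in
/-- The pairing of the simplices which do not belong to `twistedHorn m i`: the second copy of `i`
is added or removed if there are larger vertices, otherwise the first copy is. -/
noncomputable def innerToggle (hi : i < Fin.last m) : (twistedHorn.{u} m i).InnerToggle where
  vertex := pivot i
  not_face_erase_le S hS := by
    rw [face_le_twistedHorn_iff] at hS ⊢
    exact not_isSmall_erase_pivot hi hS
  vertex_insert S _ := pivot_eq_of_iff (hasLarge_insert_pivot S S)
  vertex_erase S _ := pivot_eq_of_iff (hasLarge_erase_pivot S S)
  exists_lt S hS := by
    rw [face_le_twistedHorn_iff] at hS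
    obtain ⟨x, hx, _, hx'⟩ := exists_lt_pivot hi hS
    exact ⟨x, hx, hx'⟩
  exists_gt S hS := by
    rw [face_le_twistedHorn_iff] at hS
    obtain ⟨x, hx, _, hx'⟩ := exists_pivot_lt hS
    exact ⟨x, hx, hx'⟩
  rank S := if HasLarge i S then 1 else 0
  rank_lt S T _ _ hS _ hT hST := by
    have h : HasLarge i S → HasLarge i T := fun ⟨x, hx, hx'⟩ ↦
      (hasLarge_insert_pivot T T).1 ⟨x, hST hx, hx'⟩
    -- Equal status would give equal pivots, but the pivot of `T` lies in `S` and that of `S` does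
    -- not. So `T` has a large element and `S` has none.
    have h' : ¬ (HasLarge i S ↔ HasLarge i T) := fun h' ↦ hS (by rwa [pivot_eq_of_iff h'])
    grind

end

lemma innerAnodyneExtensions_twistedHorn_ι {m : ℕ} {i : Fin (m + 1)} (hi : i < Fin.last m) :
    innerAnodyneExtensions (twistedHorn.{u} m i).ι :=
  (innerToggle hi).innerAnodyneExtensions

end TwistedArrow

/-! ### Factorizations through monomorphisms of `Δ`. -/

namespace SimplexCategory

lemma exists_comp_eq_of_range_subset {d k l : SimplexCategory} (f : k ⟶ l) [Mono f] (s : d ⟶ l)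
    (h : ∀ x, ∃ y, f.toOrderHom y = s.toOrderHom x) : ∃ t : d ⟶ k, t ≫ f = s := by
  choose t ht using h
  have hf : StrictMono f.toOrderHom :=
    f.toOrderHom.monotone.strictMono_of_injective (mono_iff_injective.1 inferInstance)
  refine ⟨Hom.mk ⟨t, fun x y hxy ↦ ?_⟩, ?_⟩
  · rw [← hf.le_iff_le, ht, ht]
    exact s.toOrderHom.monotone hxy
  · ext x : 3
    exact ht x

lemma exists_mono_range_eq {m : ℕ} (S : Set (Fin (m + 1))) (hS : S.Nonempty) :
    ∃ (k : ℕ) (f : ⦋k⦌ ⟶ ⦋m⦌), Mono f ∧ Set.range f.toOrderHom = S := by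
  classical
  obtain ⟨x, hx⟩ := SSet.stdSimplex.exists_vertices_eq.{0} S.toFinset (by simpa using hS)
  refine ⟨x.dim, SSet.stdSimplex.objEquiv x.simplex,
    (SSet.stdSimplex.mem_nonDegenerate_iff_mono _).1 x.nonDegenerate, ?_⟩
  ext j
  rw [← Set.mem_toFinset (s := S), ← hx, SSet.stdSimplex.mem_vertices]
  rfl

end SimplexCategory

/-! ### The functor `ε` on vertices. -/

namespace TwistedArrow

open SSet SSet.stdSimplex Opposite

/-- The inclusion of the first copy of `[m]`. -/
abbrev incl₁ (m : SimplexCategory) : m ⟶ epsilon.obj m :=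
  (endJoinInl SimplexCategory.rev (𝟭 SimplexCategory)).app m

/-- The inclusion of the second copy of `[m]`. -/
abbrev incl₂ (m : SimplexCategory) : m ⟶ epsilon.obj m :=
  (endJoinInr SimplexCategory.rev (𝟭 SimplexCategory)).app m

lemma incl₁_comp_map {k l : SimplexCategory} (f : k ⟶ l) :
    incl₁ k ≫ epsilon.map f = SimplexCategory.rev.map f ≫ incl₁ l :=
  ((endJoinInl SimplexCategory.rev (𝟭 SimplexCategory)).naturality f).symm

lemma incl₂_comp_map {k l : SimplexCategory} (f : k ⟶ l) :
    incl₂ k ≫ epsilon.map f = f ≫ incl₂ l :=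
  ((endJoinInr SimplexCategory.rev (𝟭 SimplexCategory)).naturality f).symm

section

variable {k m : ℕ}

/-- The inclusion of the first copy of `[m]`, on vertices. -/
def vertex₁ (x : Fin (m + 1)) : Vertex m := (incl₁ ⦋m⦌).toOrderHom x

/-- The inclusion of the second copy of `[m]`, on vertices. -/
def vertex₂ (x : Fin (m + 1)) : Vertex m := (incl₂ ⦋m⦌).toOrderHom x

/-- The action on vertices of the functor `epsilon`. -/
def vertexMap (f : ⦋k⦌ ⟶ ⦋m⦌) (x : Vertex k) : Vertex m := (epsilon.map f).toOrderHom x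

lemma val_vertex₁ (x : Fin (m + 1)) : (vertex₁ x).val = x.val :=
  congr_arg Fin.val (AugmentedSimplexCategory.inl'_eval ⦋m⦌ ⦋m⦌ x)

lemma val_vertex₂ (x : Fin (m + 1)) : (vertex₂ x).val = m + 1 + x.val :=
  congr_arg Fin.val (AugmentedSimplexCategory.inr'_eval ⦋m⦌ ⦋m⦌ x)

lemma val_vertex₁_le (x : Fin (m + 1)) : (vertex₁ x).val ≤ m := by
  rw [val_vertex₁]
  omega

lemma lt_val_vertex₂ (x : Fin (m + 1)) : m < (vertex₂ x).val := by
  rw [val_vertex₂]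
  omega

lemma eq_vertex₁_or_eq_vertex₂ (x : Vertex m) :
    (x.val ≤ m ∧ vertex₁ (fold x).rev = x) ∨ (m < x.val ∧ vertex₂ (fold x) = x) := by
  by_cases hx : x.val ≤ m
  · refine Or.inl ⟨hx, Fin.ext ?_⟩
    rw [val_vertex₁, Fin.val_rev, val_fold]
    grind
  · refine Or.inr ⟨by omega, Fin.ext ?_⟩
    rw [val_vertex₂, val_fold]
    grind

/-- Position `x` in the reversed copy stands for the element `x.rev`. -/
lemma vertexMap_vertex₁ (f : ⦋k⦌ ⟶ ⦋m⦌) (x : Fin (k + 1)) :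
    vertexMap f (vertex₁ x) = vertex₁ (f.toOrderHom x.rev).rev :=
  congr_arg (fun g : ⦋k⦌ ⟶ epsilon.obj ⦋m⦌ ↦ g.toOrderHom x) (incl₁_comp_map f)

lemma vertexMap_vertex₂ (f : ⦋k⦌ ⟶ ⦋m⦌) (x : Fin (k + 1)) :
    vertexMap f (vertex₂ x) = vertex₂ (f.toOrderHom x) :=
  congr_arg (fun g : ⦋k⦌ ⟶ epsilon.obj ⦋m⦌ ↦ g.toOrderHom x) (incl₂_comp_map f)

lemma fold_vertex₁ (x : Fin (m + 1)) : fold (vertex₁ x) = x.rev := by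
  ext
  rw [val_fold, val_vertex₁, Fin.val_rev]
  grind

lemma fold_vertex₂ (x : Fin (m + 1)) : fold (vertex₂ x) = x := by
  ext
  rw [val_fold, val_vertex₂]
  grind

/-- `fold` reverses the order on the first half, so this is an identity of functions on vertices,
not of morphisms of `Δ`. -/
lemma fold_vertexMap (f : ⦋k⦌ ⟶ ⦋m⦌) (x : Vertex k) :
    fold (vertexMap f x) = f.toOrderHom (fold x) := by
  obtain ⟨-, hx⟩ | ⟨-, hx⟩ := eq_vertex₁_or_eq_vertex₂ x
  · conv_lhs => rw [← hx]
    rw [vertexMap_vertex₁, fold_vertex₁, Fin.rev_rev, Fin.rev_rev]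
  · conv_lhs => rw [← hx]
    rw [vertexMap_vertex₂, fold_vertex₂]

lemma val_vertexMap_le_iff (f : ⦋k⦌ ⟶ ⦋m⦌) (x : Vertex k) :
    (vertexMap f x).val ≤ m ↔ x.val ≤ k := by
  obtain ⟨h, hx⟩ | ⟨h, hx⟩ := eq_vertex₁_or_eq_vertex₂ x
  · refine iff_of_true ?_ h
    rw [← hx, vertexMap_vertex₁]
    exact val_vertex₁_le _
  · refine iff_of_false ?_ h.not_ge
    rw [← hx, vertexMap_vertex₂]
    exact (lt_val_vertex₂ _).not_ge

lemma vertexMap_injective (f : ⦋k⦌ ⟶ ⦋m⦌) [Mono f] : Function.Injective (vertexMap f) :=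
  fun x y h ↦ eq_of_fold_eq
    (SimplexCategory.mono_iff_injective.1 (inferInstance : Mono f)
      (by rw [← fold_vertexMap, ← fold_vertexMap, h]))
    (by rw [← val_vertexMap_le_iff f, ← val_vertexMap_le_iff f, h])

instance (m : ℕ) : Mono (incl₁ ⦋m⦌) :=
  SimplexCategory.mono_iff_injective.2 fun x y (h : vertex₁ x = vertex₁ y) ↦
    Fin.rev_injective (by rw [← fold_vertex₁ x, h, fold_vertex₁])

instance (m : ℕ) : Mono (incl₂ ⦋m⦌) :=
  SimplexCategory.mono_iff_injective.2 fun x y (h : vertex₂ x = vertex₂ y) ↦ by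
    rw [← fold_vertex₂ x, h, fold_vertex₂]

instance (f : ⦋k⦌ ⟶ ⦋m⦌) [Mono f] : Mono (epsilon.map f) :=
  SimplexCategory.mono_iff_injective.2 (vertexMap_injective f)

variable {d : SimplexCategory}

/-- The vertices of a simplex of `[m]ᵒᵖ ⋆ [m]`. -/
def vertex (s : d ⟶ epsilon.obj ⦋m⦌) (x : Fin (d.len + 1)) : Vertex m := s.toOrderHom x

lemma exists_comp_incl₁_eq (s : d ⟶ epsilon.obj ⦋m⦌) (hs : ∀ x, (vertex s x).val ≤ m) :
    ∃ t, t ≫ incl₁ ⦋m⦌ = s :=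
  SimplexCategory.exists_comp_eq_of_range_subset _ _ fun x ↦ by
    obtain ⟨-, h⟩ | ⟨h, -⟩ := eq_vertex₁_or_eq_vertex₂ (vertex s x)
    · exact ⟨_, h⟩
    · exact (h.not_ge (hs x)).elim

lemma exists_comp_incl₂_eq (s : d ⟶ epsilon.obj ⦋m⦌) (hs : ∀ x, m < (vertex s x).val) :
    ∃ t, t ≫ incl₂ ⦋m⦌ = s :=
  SimplexCategory.exists_comp_eq_of_range_subset _ _ fun x ↦ by
    obtain ⟨h, -⟩ | ⟨-, h⟩ := eq_vertex₁_or_eq_vertex₂ (vertex s x)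
    · exact (h.not_gt (hs x)).elim
    · exact ⟨_, h⟩

/-- The image of `epsilon.map f` consists of both copies of the image of `f`, so `fold` detects it.
-/
lemma exists_comp_map_eq (f : ⦋k⦌ ⟶ ⦋m⦌) [Mono f] (s : d ⟶ epsilon.obj ⦋m⦌)
    (hs : ∀ x, fold (vertex s x) ∈ Set.range f.toOrderHom) :
    ∃ t, t ≫ epsilon.map f = s :=
  SimplexCategory.exists_comp_eq_of_range_subset _ _ fun x ↦ by
    obtain ⟨y, hy⟩ := hs x
    obtain ⟨-, h⟩ | ⟨-, h⟩ := eq_vertex₁_or_eq_vertex₂ (vertex s x)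
    · refine ⟨vertex₁ (Fin.rev y), (vertexMap_vertex₁ f _).trans ?_⟩
      rw [Fin.rev_rev, hy]
      exact h
    · refine ⟨vertex₂ y, (vertexMap_vertex₂ f _).trans ?_⟩
      rw [hy]
      exact h

end

end TwistedArrow

/-! ### Gluing lifting data to a map from the twisted horn to `C`. -/

namespace TwistedArrow

open SSet SSet.stdSimplex Opposite

section

variable {m : ℕ} {i : Fin (m + 1)} {C : SSet.{u}}

/-- The simplex of `C` given by the image in the twisted arrow simplicial set of a simplex
of a horn. -/
def hornValue (α : (Λ[m, i] : SSet.{u}) ⟶ twistedArrow.obj C) {k : ℕ} (e : ⦋k⦌ ⟶ ⦋m⦌)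
    (he : objEquiv.symm e ∈ Λ[m, i].obj (op ⦋k⦌)) : C.obj (op (epsilon.obj ⦋k⦌)) :=
  α.app (op ⦋k⦌) ⟨objEquiv.symm e, he⟩

lemma map_hornValue (α : (Λ[m, i] : SSet.{u}) ⟶ twistedArrow.obj C) {k l : ℕ} (e : ⦋k⦌ ⟶ ⦋m⦌)
    (he : objEquiv.symm e ∈ Λ[m, i].obj (op ⦋k⦌)) (f : ⦋l⦌ ⟶ ⦋k⦌) :
    C.map (epsilon.map f).op (hornValue α e he) =
      hornValue α (f ≫ e) (Λ[m, i].map f.op he) :=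
  (NatTrans.naturality_apply α f.op ⟨objEquiv.symm e, he⟩).symm

variable (i C) in
/-- The data of a map from a horn to the twisted arrow simplicial set and of compatible simplices
of `C.op` and `C`. -/
structure LiftingData where
  /-- the map from the horn -/
  map : (Λ[m, i] : SSet.{u}) ⟶ twistedArrow.obj C
  /-- the simplex of `C.op`, considered as a simplex of `C` -/
  fst : C.obj (op ⦋m⦌)
  /-- the simplex of `C` -/
  snd : C.obj (op ⦋m⦌)
  map_fst {k : ℕ} (e : ⦋k⦌ ⟶ ⦋m⦌) (he : objEquiv.symm e ∈ Λ[m, i].obj (op ⦋k⦌)) :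
    C.map (SimplexCategory.rev.map e).op fst = C.map (incl₁ ⦋k⦌).op (hornValue map e he)
  map_snd {k : ℕ} (e : ⦋k⦌ ⟶ ⦋m⦌) (he : objEquiv.symm e ∈ Λ[m, i].obj (op ⦋k⦌)) :
    C.map e.op snd = C.map (incl₂ ⦋k⦌).op (hornValue map e he)

namespace LiftingData

variable (D : LiftingData i C) {d : SimplexCategory}

/-- The relation between the simplices of `twistedHorn m i` and their images in `C`. -/
inductive IsValue (s : d ⟶ epsilon.obj ⦋m⦌) (c : C.obj (op d)) : Prop where
  | ofFst (t : d ⟶ ⦋m⦌) (ht : t ≫ incl₁ ⦋m⦌ = s) (hc : C.map t.op D.fst = c)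
  | ofSnd (t : d ⟶ ⦋m⦌) (ht : t ≫ incl₂ ⦋m⦌ = s) (hc : C.map t.op D.snd = c)
  | ofFace {k : ℕ} (e : ⦋k⦌ ⟶ ⦋m⦌) [Mono e] (he : objEquiv.symm e ∈ Λ[m, i].obj (op ⦋k⦌))
      (t : d ⟶ epsilon.obj ⦋k⦌) (ht : t ≫ epsilon.map e = s)
      (hc : C.map t.op (hornValue D.map e he) = c)

variable {D}

lemma IsValue.comp {s : d ⟶ epsilon.obj ⦋m⦌} {c : C.obj (op d)} (h : D.IsValue s c)
    {d' : SimplexCategory} (f : d' ⟶ d) : D.IsValue (f ≫ s) (C.map f.op c) := by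
  cases h with
  | ofFst t ht hc => exact .ofFst (f ≫ t) (by rw [Category.assoc, ht]) (by simp [← hc])
  | ofSnd t ht hc => exact .ofSnd (f ≫ t) (by rw [Category.assoc, ht]) (by simp [← hc])
  | ofFace e he t ht hc => exact .ofFace e he (f ≫ t) (by rw [Category.assoc, ht]) (by simp [← hc])

variable (D) in
lemma exists_isValue (s : d ⟶ epsilon.obj ⦋m⦌) (hs : IsSmall i (Set.range (vertex s))) :
    ∃ c, D.IsValue s c := by
  obtain hs | hs | ⟨j, hj, hs⟩ := hs
  · obtain ⟨t, ht⟩ := exists_comp_incl₁_eq s fun x ↦ hs _ ⟨x, rfl⟩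
    exact ⟨_, .ofFst t ht rfl⟩
  · obtain ⟨t, ht⟩ := exists_comp_incl₂_eq s fun x ↦ hs _ ⟨x, rfl⟩
    exact ⟨_, .ofSnd t ht rfl⟩
  -- The face spanned by the folded vertices of `s` is the smallest `σ` with `s` in `σᵒᵖ ⋆ σ`. It
  -- omits `j`, so it lies in the horn.
  · obtain ⟨k, e, _, he⟩ := SimplexCategory.exists_mono_range_eq
      (Set.range (fold ∘ vertex s)) (Set.range_nonempty _)
    obtain ⟨t, ht⟩ := exists_comp_map_eq e s fun x ↦ by
      rw [he]
      exact ⟨x, rfl⟩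
    refine ⟨_, .ofFace e ?_ t ht rfl⟩
    rw [mem_horn_iff_notMem_range]
    refine ⟨j, hj, fun h ↦ ?_⟩
    obtain ⟨x, hx⟩ := he.le h
    exact hs _ ⟨x, rfl⟩ hx

lemma fold_vertex_mem_range {k : ℕ} {e : ⦋k⦌ ⟶ ⦋m⦌} {s : d ⟶ epsilon.obj ⦋m⦌}
    {t : d ⟶ epsilon.obj ⦋k⦌} (h : t ≫ epsilon.map e = s) (x : Fin (d.len + 1)) :
    fold (vertex s x) ∈ Set.range e.toOrderHom := by
  subst h
  exact ⟨_, (fold_vertexMap e (vertex t x)).symm⟩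

lemma IsValue.isSmall {s : d ⟶ epsilon.obj ⦋m⦌} {c : C.obj (op d)} (h : D.IsValue s c) :
    IsSmall i (Set.range (vertex s)) := by
  cases h with
  | ofFst t ht hc =>
    subst ht
    refine Or.inl ?_
    rintro _ ⟨x, rfl⟩
    exact val_vertex₁_le (t.toOrderHom x)
  | ofSnd t ht hc =>
    subst ht
    refine Or.inr (Or.inl ?_)
    rintro _ ⟨x, rfl⟩
    exact lt_val_vertex₂ (t.toOrderHom x)
  | ofFace e he t ht hc =>
    obtain ⟨j, hj, hj'⟩ := (mem_horn_iff_notMem_range _ _).1 he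
    refine Or.inr (Or.inr ⟨j, hj, ?_⟩)
    rintro _ ⟨x, rfl⟩ rfl
    exact hj' (fold_vertex_mem_range ht x)

/-- `epsilon.map e` preserves the two halves, so `t` also lies in the first one; cancelling the
monomorphism `incl₁` reduces the claim to `map_fst`. -/
lemma eq_of_face_fst {k : ℕ} {e : ⦋k⦌ ⟶ ⦋m⦌} [Mono e]
    (he : objEquiv.symm e ∈ Λ[m, i].obj (op ⦋k⦌))
    {t : d ⟶ epsilon.obj ⦋k⦌} {t' : d ⟶ ⦋m⦌} (h : t' ≫ incl₁ ⦋m⦌ = t ≫ epsilon.map e) :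
    C.map t'.op D.fst = C.map t.op (hornValue D.map e he) := by
  obtain ⟨u, rfl⟩ := exists_comp_incl₁_eq t fun x ↦ by
    rw [← val_vertexMap_le_iff e]
    have : vertexMap e (vertex t x) = vertex₁ (t'.toOrderHom x) :=
      congr_arg (fun g : d ⟶ epsilon.obj ⦋m⦌ ↦ g.toOrderHom x) h.symm
    rw [this]
    exact val_vertex₁_le _
  rw [Category.assoc, incl₁_comp_map, ← Category.assoc, cancel_mono] at h
  subst h
  rw [op_comp, op_comp, Functor.map_comp_apply, Functor.map_comp_apply, D.map_fst e he]

lemma eq_of_face_snd {k : ℕ} {e : ⦋k⦌ ⟶ ⦋m⦌} [Mono e]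
    (he : objEquiv.symm e ∈ Λ[m, i].obj (op ⦋k⦌))
    {t : d ⟶ epsilon.obj ⦋k⦌} {t' : d ⟶ ⦋m⦌} (h : t' ≫ incl₂ ⦋m⦌ = t ≫ epsilon.map e) :
    C.map t'.op D.snd = C.map t.op (hornValue D.map e he) := by
  obtain ⟨u, rfl⟩ := exists_comp_incl₂_eq t fun x ↦ by
    rw [← not_le, ← val_vertexMap_le_iff e, not_le]
    have : vertexMap e (vertex t x) = vertex₂ (t'.toOrderHom x) :=
      congr_arg (fun g : d ⟶ epsilon.obj ⦋m⦌ ↦ g.toOrderHom x) h.symm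
    rw [this]
    exact lt_val_vertex₂ _
  rw [Category.assoc, incl₂_comp_map, ← Category.assoc, cancel_mono] at h
  subst h
  rw [op_comp, op_comp, Functor.map_comp_apply, Functor.map_comp_apply, D.map_snd e he]

lemma incl₁_ne_incl₂ (t t' : d ⟶ ⦋m⦌) : t ≫ incl₁ ⦋m⦌ ≠ t' ≫ incl₂ ⦋m⦌ := fun h ↦ by
  have h' : vertex₁ (t.toOrderHom 0) = vertex₂ (t'.toOrderHom 0) :=
    congr_arg (fun g : d ⟶ epsilon.obj ⦋m⦌ ↦ g.toOrderHom 0) h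
  exact ((lt_val_vertex₂ _).trans_eq (congr_arg Fin.val h'.symm)).not_ge (val_vertex₁_le _)

/-- Both faces contain the face `τ` spanned by the folded vertices of `s`, so both values are the
one computed from `τ`. -/
lemma eq_of_face_face {s : d ⟶ epsilon.obj ⦋m⦌} {k k' : ℕ} {e : ⦋k⦌ ⟶ ⦋m⦌} [Mono e]
    (he : objEquiv.symm e ∈ Λ[m, i].obj (op ⦋k⦌)) {t : d ⟶ epsilon.obj ⦋k⦌}
    (h : t ≫ epsilon.map e = s) {e' : ⦋k'⦌ ⟶ ⦋m⦌} [Mono e']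
    (he' : objEquiv.symm e' ∈ Λ[m, i].obj (op ⦋k'⦌)) {t' : d ⟶ epsilon.obj ⦋k'⦌}
    (h' : t' ≫ epsilon.map e' = s) :
    C.map t.op (hornValue D.map e he) = C.map t'.op (hornValue D.map e' he') := by
  obtain ⟨l, τ, _, hτ⟩ := SimplexCategory.exists_mono_range_eq
    (Set.range (fold ∘ vertex s)) (Set.range_nonempty _)
  obtain ⟨w, hw⟩ := exists_comp_map_eq τ s fun x ↦ by
    rw [hτ]
    exact ⟨x, rfl⟩
  have key {p : ℕ} (f : ⦋p⦌ ⟶ ⦋m⦌) [Mono f] (hf : objEquiv.symm f ∈ Λ[m, i].obj (op ⦋p⦌))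
      (r : d ⟶ epsilon.obj ⦋p⦌) (hr : r ≫ epsilon.map f = s) :
      ∃ hτ' : objEquiv.symm τ ∈ Λ[m, i].obj (op ⦋l⦌),
        C.map r.op (hornValue D.map f hf) = C.map w.op (hornValue D.map τ hτ') := by
    obtain ⟨v, rfl⟩ := SimplexCategory.exists_comp_eq_of_range_subset f τ fun y ↦ by
      obtain ⟨x, hx⟩ : τ.toOrderHom y ∈ Set.range (fold ∘ vertex s) := by
        rw [← hτ]
        exact ⟨y, rfl⟩
      rw [← hx]
      exact fold_vertex_mem_range hr x
    obtain rfl : w ≫ epsilon.map v = r := by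
      rw [← cancel_mono (epsilon.map f), hr, ← hw, Category.assoc, Functor.map_comp]
    exact ⟨Λ[m, i].map v.op hf, by rw [op_comp, Functor.map_comp_apply, map_hornValue]⟩
  obtain ⟨_, h₁⟩ := key e he t h
  obtain ⟨_, h₂⟩ := key e' he' t' h'
  rw [h₁, h₂]

lemma IsValue.unique {s : d ⟶ epsilon.obj ⦋m⦌} {c c' : C.obj (op d)} (h : D.IsValue s c)
    (h' : D.IsValue s c') : c = c' := by
  cases h with
  | ofFst t ht hc =>
    subst hc
    cases h' with
    | ofFst t' ht' hc' => rw [← hc', (cancel_mono (incl₁ ⦋m⦌)).1 (ht.trans ht'.symm)]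
    | ofSnd t' ht' hc' => exact (incl₁_ne_incl₂ _ _ (ht.trans ht'.symm)).elim
    | ofFace e' he' t' ht' hc' => rw [← hc', eq_of_face_fst he' (ht.trans ht'.symm)]
  | ofSnd t ht hc =>
    subst hc
    cases h' with
    | ofFst t' ht' hc' => exact (incl₁_ne_incl₂ _ _ (ht'.trans ht.symm)).elim
    | ofSnd t' ht' hc' => rw [← hc', (cancel_mono (incl₂ ⦋m⦌)).1 (ht.trans ht'.symm)]
    | ofFace e' he' t' ht' hc' => rw [← hc', eq_of_face_snd he' (ht.trans ht'.symm)]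
  | ofFace e he t ht hc =>
    subst hc
    cases h' with
    | ofFst t' ht' hc' => rw [← hc', eq_of_face_fst he (ht'.trans ht.symm)]
    | ofSnd t' ht' hc' => rw [← hc', eq_of_face_snd he (ht'.trans ht.symm)]
    | ofFace e' he' t' ht' hc' => rw [← hc', eq_of_face_face he ht he' ht']

variable (D)

lemma exists_isValue_of_mem {d : SimplexCategoryᵒᵖ} (s : (twistedHorn.{u} m i : SSet.{u}).obj d) :
    ∃ c, D.IsValue (d := d.unop) (objEquiv s.1) c :=
  D.exists_isValue _ s.2

/-- The map from `twistedHorn m i` to `C` that is determined by lifting data. -/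
noncomputable def desc : (twistedHorn.{u} m i : SSet.{u}) ⟶ C where
  app d := TypeCat.ofHom fun s ↦ (D.exists_isValue_of_mem s).choose
  naturality d d' f := by
    ext s
    -- Uniqueness of values makes the pointwise choices natural.
    exact ((D.exists_isValue_of_mem _).choose_spec).unique
      ((D.exists_isValue_of_mem s).choose_spec.comp f.unop)

lemma desc_app_eq {d : SimplexCategory} (s : d ⟶ epsilon.obj ⦋m⦌)
    (hs : objEquiv.symm s ∈ (twistedHorn.{u} m i).obj (op d)) {c : C.obj (op d)}
    (h : D.IsValue s c) : D.desc.app (op d) ⟨objEquiv.symm s, hs⟩ = c :=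
  (D.exists_isValue_of_mem ⟨objEquiv.symm s, hs⟩).choose_spec.unique h

end LiftingData

end

end TwistedArrow

/-! ### Opposites and products of quasicategories. -/

namespace SSet

open Opposite

/-- Inner horns lift to the opposite of a quasicategory. -/
lemma Quasicategory.op_hornFilling (C : SSet.{u}) [Quasicategory C] {n : ℕ} {i : Fin (n + 1)}
    (h0 : 0 < i) (hn : i < Fin.last n) (f : (Λ[n, i] : SSet.{u}) ⟶ C.op) :
    ∃ g : Δ[n] ⟶ C.op, f = Λ[n, i].ι ≫ g := by
  have hi {d : SimplexCategoryᵒᵖ} (x : (Λ[n, i.rev] : SSet.{u}).obj d) :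
      opObjEquiv (stdSimplex.opObjEquiv.symm x.1) ∈ Λ[n, i].obj d :=
    (congr_arg (fun A : (Δ[n] : SSet.{u}).Subcomplex ↦ x.1 ∈ A.obj d) (op_horn i)).mpr x.2
  -- The opposite of `f`: reversing orders exchanges the horns at `i` and `i.rev`, and inner horns
  -- stay inner.
  let f' : (Λ[n, i.rev] : SSet.{u}) ⟶ C :=
    { app d := TypeCat.ofHom fun x ↦ opObjEquiv (f.app d ⟨_, hi x⟩)
      naturality d d' φ := by
        ext x
        have h := NatTrans.naturality_apply f (SimplexCategory.rev.map φ.unop).op ⟨_, hi x⟩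
        rw [op_map] at h
        simp only [Quiver.Hom.unop_op, SimplexCategory.rev_map_rev_map, Quiver.Hom.op_unop] at h
        refine Eq.trans (congr_arg (fun y ↦ opObjEquiv (f.app d' y)) (Subtype.ext ?_))
          (congr_arg opObjEquiv h)
        exact congr_arg stdSimplex.objEquiv.symm
          (SimplexCategory.rev.map_comp φ.unop (stdSimplex.objEquiv x.1)) }
  obtain ⟨g, hg⟩ := Quasicategory.hornFilling (S := C) (i := i.rev)
    (by rwa [← Fin.rev_last, Fin.rev_lt_rev]) (by rwa [← Fin.rev_zero, Fin.rev_lt_rev]) f'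
  refine ⟨(stdSimplex.opIso ⦋n⦌).inv ≫ opFunctor.map g, ?_⟩
  ext d y
  have hy : (stdSimplex.opIso ⦋n⦌).inv.app d ((stdSimplex.opIso ⦋n⦌).hom.app d
      (opObjEquiv.symm y.1)) = opObjEquiv.symm y.1 :=
    ConcreteCategory.congr_hom ((stdSimplex.opIso ⦋n⦌).hom_inv_id_app d) _
  have hx : (stdSimplex.opIso ⦋n⦌).hom.app d (opObjEquiv.symm y.1) ∈ Λ[n, i.rev].obj d := by
    rw [← op_horn]
    exact (congr_arg (fun z ↦ z ∈ Λ[n, i].op.obj d) hy).mpr y.2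
  have h := congr_arg opObjEquiv.symm (ConcreteCategory.congr_hom (NatTrans.congr_app hg d) ⟨_, hx⟩)
  refine Eq.trans (congr_arg (f.app d) (Subtype.ext ?_)) h
  exact hy.symm

instance Quasicategory.op (C : SSet.{u}) [Quasicategory C] : Quasicategory C.op where
  hornFilling' _ _ f h0 hn := op_hornFilling C h0 hn f

instance Quasicategory.tensorObj (C D : SSet.{u}) [Quasicategory C] [Quasicategory D] :
    Quasicategory (C ⊗ D) where
  hornFilling' _ _ f h0 hn := by
    obtain ⟨g, hg⟩ := hornFilling h0 hn (f ≫ CartesianMonoidalCategory.fst C D)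
    obtain ⟨h, hh⟩ := hornFilling h0 hn (f ≫ CartesianMonoidalCategory.snd C D)
    refine ⟨CartesianMonoidalCategory.lift g h, ?_⟩
    apply CartesianMonoidalCategory.hom_ext <;> simp [hg, hh]

end SSet

/-! ### Solving the lifting problem. -/

namespace TwistedArrow

open SSet SSet.stdSimplex Opposite

theorem leftFibrations_projection (C : SSet.{u}) [Quasicategory C] :
    leftFibrations (projection C) := by
  rintro _ _ _ @⟨n, i, hi⟩
  refine ⟨fun {α β} sq ↦ ?_⟩
  let b := SSet.yonedaEquiv β
  have hβ {k : SimplexCategory} (e : k ⟶ ⦋n + 1⦌) :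
      β.app (op k) (objEquiv.symm e) = (C.op ⊗ C).map e.op b := by
    conv_lhs => rw [← SSet.yonedaEquiv.symm_apply_apply β]
    exact yonedaEquiv_symm_app_objEquiv_symm b e
  have hb {k : ℕ} (e : ⦋k⦌ ⟶ ⦋n + 1⦌) (he : objEquiv.symm e ∈ Λ[n + 1, i].obj (op ⦋k⦌)) :
      (projection C).app (op ⦋k⦌) (hornValue α e he) = (C.op ⊗ C).map e.op b :=
    (ConcreteCategory.congr_hom (NatTrans.congr_app sq.w (op ⦋k⦌)) ⟨objEquiv.symm e, he⟩).trans (hβ e)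
  let D : LiftingData i C :=
    { map := α
      fst := b.1
      snd := b.2
      map_fst e he := (congr_arg Prod.fst (hb e he)).symm
      map_snd e he := (congr_arg Prod.snd (hb e he)).symm }
  have : HasLiftingProperty (twistedHorn.{u} (n + 1) i).ι (Limits.terminal.from C) :=
    innerAnodyneExtensions_twistedHorn_ι hi _ (mem_innerFibrations _)
  have sq' : CommSq D.desc (twistedHorn.{u} (n + 1) i).ι (Limits.terminal.from C)
    (Limits.terminal.from _) := ⟨Subsingleton.elim _ _⟩
  -- By definition of `Õ`, this `(2m+1)`-simplex of `C` is an `m`-simplex of `Õ(C)`, which gives the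
  -- lift.
  let g : C.obj (op (epsilon.obj ⦋n + 1⦌)) := SSet.yonedaEquiv sq'.lift
  have hg {d : SimplexCategory} (s : d ⟶ epsilon.obj ⦋n + 1⦌) (c : C.obj (op d))
      (h : D.IsValue s c) : C.map s.op g = c := by
    refine Eq.trans ?_ (D.desc_app_eq s h.isSmall h)
    rw [← sq'.fac_left]
    exact congr_arg (fun φ : Δ[n + 1 + (n + 1) + 1] ⟶ C ↦ φ.app (op d) (objEquiv.symm s))
      (SSet.yonedaEquiv.symm_apply_apply sq'.lift)
  have hid {d : SimplexCategory} (c : C.obj (op d)) : C.map (𝟙 d).op c = c :=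
    ConcreteCategory.congr_hom (C.map_id (op d)) c
  refine ⟨⟨⟨(SSet.yonedaEquiv (X := twistedArrow.obj C)).symm g, ?_, ?_⟩⟩⟩
  -- A map from the horn is determined by its faces `δ j`, `j ≠ i`, where the value of `g` is
  -- prescribed by `ofFace`.
  · apply horn.hom_ext
    intro j hj
    refine hg (epsilon.map (SimplexCategory.δ j)) _ (.ofFace (SimplexCategory.δ j)
      (horn.face i j hj).2 (𝟙 _) (Category.id_comp _) ?_)
    exact hid _
  · apply SSet.yonedaEquiv.injective
    refine (congr_arg ((projection C).app (op ⦋n + 1⦌))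
      ((SSet.yonedaEquiv (X := twistedArrow.obj C)).apply_symm_apply g)).trans (Prod.ext ?_ ?_)
    -- The two components of the projection restrict `g` to the two halves, where it is prescribed
    -- by `ofFst` and `ofSnd`.
    · exact hg (incl₁ ⦋n + 1⦌) b.1 (.ofFst (𝟙 _) (Category.id_comp _) (hid _))
    · exact hg (incl₂ ⦋n + 1⦌) b.2 (.ofSnd (𝟙 _) (Category.id_comp _) (hid _))

lemma innerHornInclusions_le_leftHornInclusions :
    innerHornInclusions.{u} ≤ leftHornInclusions := fun _ _ _ ⟨i, _, hi⟩ ↦ ⟨i, hi⟩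

lemma leftFibrations_le_innerFibrations : leftFibrations.{u} ≤ innerFibrations :=
  MorphismProperty.antitone_rlp innerHornInclusions_le_leftHornInclusions

end TwistedArrow

theorem proposition1p1 (C : SSet.{u}) [SSet.Quasicategory C] :
    TwistedArrow.leftFibrations (TwistedArrow.projection C) ∧
      SSet.Quasicategory (TwistedArrow.twistedArrow.obj C) := by
  have h := TwistedArrow.leftFibrations_projection C
  have : SSet.InnerFibration (TwistedArrow.projection C) :=
    ⟨TwistedArrow.leftFibrations_le_innerFibrations _ h⟩
  exact ⟨h, SSet.quasicategory_of_innerFibration (TwistedArrow.projection C)⟩
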